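/- Let $\zeta$ be the Riemann zeta function, $\zeta'$ its derivative, and let $B_j$ denote the Bernoulli numbers, defined by $\frac{x}{e^x-1}=\sum_{j\ge 0}B_j\frac{x^j}{j!}$ for $|x|<2\pi$. For every positive integer $n$, the series and the integral below converge absolutely, and $$\zeta'(2n+1)=\ln\!\left(\frac{\pi}{2^{1/(2^{2n}-1)}}\right)\zeta(2n+1)+\frac{(-1)^n(2\pi)^{2n}}{2^{2n}-1}\left[\sum_{k=0}^{\infty}\frac{(2^{2k}-2)\,B_{2k}}{(2k)!\,(2n-2k+1)^2}+\int_1^{\infty}\frac{\ln t}{t^{2n+1}\sinh t}\,\mathrm{d}t\right].$$ -/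

import Mathlib

open MeasureTheory

/-! Compute the Mellin transform of `1 / sinh t` in two ways. Expanding `1 / sinh t = 2 ∑ exp
(-(2k+1)t)` gives `2 Γ(s) (1 - 2^(-s)) ζ(s)` for `Re s > 1` (`mellin_csch`), which the functional
equation turns into `cschZeta`, an expression in `ζ(1 - s)`. Splitting the integral at `t = 1` and
inserting the Bernoulli series of `t / sinh t` on `(0, 1]` gives a sum of simple fractions plus an
entire tail (`mellin_csch_eq_cschContinuation`). Both expressions are holomorphic away from the odd
integers and `0`, where `ζ(1 - s)` has its pole, so they agree there by the identity theorem
(`cschZeta_eqOn_cschContinuation`). Differentiating at `s = -2n`, where the sine vanishes and the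
cosine is `(-1)^n`, gives a linear equation for `ζ'(2n+1)`: the fractions yield the Bernoulli
series, the tail yields the logarithmic integral. -/

/-! ### Bernoulli numbers and their generating series. -/

/-- For even `j > 0` the left side is `2 ζ(j) ≤ 2 ζ(2) = π² / 3`; for `j = 1` it is `π`. The
constant 4 covers both. -/
theorem abs_bernoulli_div_factorial_mul_two_pi_pow_le (j : ℕ) :
    |(bernoulli j : ℝ) / (j.factorial : ℝ)| * (2 * Real.pi) ^ j ≤ 4 := by
  rcases Nat.even_or_odd' j with ⟨k, rfl | rfl⟩
  · rcases Nat.eq_zero_or_pos k with rfl | hk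
    · simp
    have h := hasSum_zeta_nat hk.ne'
    have h2 := hasSum_zeta_two
    have hle := hasSum_le (fun m : ℕ => ?_) h h2
    · have hnn := h.nonneg (fun m => by positivity)
      have hpow : (2 : ℝ) ^ (2 * k) = 2 * 2 ^ (2 * k - 1) := by
        rw [← pow_succ']; congr 1; omega
      have habs : |(bernoulli (2 * k) : ℝ) / ((2 * k).factorial : ℝ)| * (2 * Real.pi) ^ (2 * k) =
          2 * |(-1 : ℝ) ^ (k + 1) * (2 : ℝ) ^ (2 * k - 1) * Real.pi ^ (2 * k) *
            bernoulli (2 * k) / ((2 * k).factorial : ℝ)| := by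
        simp only [abs_mul, abs_div, abs_pow, abs_neg, abs_one, one_pow, one_mul,
          abs_of_pos Real.pi_pos, Nat.abs_ofNat, mul_pow, hpow, Nat.abs_cast]
        ring
      rw [habs, abs_of_nonneg hnn]
      nlinarith [Real.pi_lt_d2, Real.pi_pos]
    · rcases Nat.eq_zero_or_pos m with rfl | hm
      · simp [hk.ne']
      · have h1 : (1 : ℝ) ≤ m := by exact_mod_cast hm
        exact one_div_le_one_div_of_le (by positivity) (pow_le_pow_right₀ h1 (by omega))
  · rcases Nat.eq_zero_or_pos k with rfl | hk
    · norm_num [bernoulli_one, abs_of_pos]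
      linarith [Real.pi_lt_d2]
    · rw [bernoulli_eq_zero_of_odd ⟨k, rfl⟩ (by omega)]
      simp

theorem summable_abs_bernoulli_mul_pow {x : ℝ} (hx : |x| < 2 * Real.pi) :
    Summable (fun j : ℕ => |(bernoulli j : ℝ) / (j.factorial : ℝ) * x ^ j|) := by
  have hp : 0 < 2 * Real.pi := Real.two_pi_pos
  have hg : Summable (fun j : ℕ => 4 * (|x| / (2 * Real.pi)) ^ j) :=
    (summable_geometric_of_lt_one (by positivity) ((div_lt_one hp).2 hx)).mul_left 4
  refine hg.of_nonneg_of_le (fun j => abs_nonneg _) (fun j => ?_)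
  have := abs_bernoulli_div_factorial_mul_two_pi_pow_le j
  rw [abs_mul, abs_pow, div_pow, ← mul_div_assoc, le_div_iff₀ (by positivity)]
  nlinarith [pow_nonneg (abs_nonneg x) j]

/-- The formal identity `(∑ B_j X^j / j!) (exp X - 1) = X`, read coefficientwise and scaled by `x ^
m`; it evaluates the Cauchy product in `hasSum_bernoulli_mul_pow`. -/
theorem sum_antidiagonal_bernoulli_mul_pow (x : ℝ) (m : ℕ) :
    (∑ kl ∈ Finset.HasAntidiagonal.antidiagonal m,
      ((bernoulli kl.1 : ℝ) / (kl.1.factorial : ℝ) * x ^ kl.1) *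
        (x ^ kl.2 / (kl.2.factorial : ℝ) - if kl.2 = 0 then (1 : ℝ) else 0)) =
      if m = 1 then x else 0 := by
  have h := congrArg (PowerSeries.coeff m) (bernoulliPowerSeries_mul_exp_sub_one ℝ)
  rw [PowerSeries.coeff_mul, PowerSeries.coeff_X] at h
  trans (if m = 1 then (1 : ℝ) else 0) * x ^ m
  · rw [← h, Finset.sum_mul]
    refine Finset.sum_congr rfl fun kl hkl => ?_
    rw [Finset.HasAntidiagonal.mem_antidiagonal] at hkl
    rw [← hkl]
    simp only [bernoulliPowerSeries, PowerSeries.coeff_mk, map_sub, PowerSeries.coeff_exp,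
      PowerSeries.coeff_one, pow_add, eq_ratCast]
    push_cast
    by_cases h0 : kl.2 = 0
    · simp [h0]
    · simp only [h0, if_false]
      ring
  · by_cases h1 : m = 1
    · simp [h1]
    · simp [h1]

theorem hasSum_bernoulli_mul_pow {x : ℝ} (hx : |x| < 2 * Real.pi) (hx0 : x ≠ 0) :
    HasSum (fun j : ℕ => (bernoulli j : ℝ) / (j.factorial : ℝ) * x ^ j) (x / (Real.exp x - 1)) := by
  have hs := summable_abs_bernoulli_mul_pow hx
  have he0 : HasSum (fun j : ℕ => x ^ j / (j.factorial : ℝ)) (Real.exp x) := by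
    rw [Real.exp_eq_exp_ℝ]; exact NormedSpace.expSeries_div_hasSum_exp x
  have hs0 : HasSum (fun j : ℕ => if j = 0 then (1 : ℝ) else 0) 1 := hasSum_ite_eq 0 1
  have he : HasSum (fun j : ℕ => x ^ j / (j.factorial : ℝ) - if j = 0 then (1 : ℝ) else 0)
      (Real.exp x - 1) := he0.sub hs0
  have hprod := tsum_mul_tsum_eq_tsum_sum_antidiagonal_of_summable_norm
    (f := fun j : ℕ => (bernoulli j : ℝ) / (j.factorial : ℝ) * x ^ j)
    (g := fun j : ℕ => x ^ j / (j.factorial : ℝ) - if j = 0 then (1 : ℝ) else 0)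
    (by simpa only [Real.norm_eq_abs] using hs) he.summable.norm
  rw [he.tsum_eq, tsum_congr (sum_antidiagonal_bernoulli_mul_pow x), tsum_ite_eq] at hprod
  have hne : Real.exp x - 1 ≠ 0 := by
    rw [sub_ne_zero]; simpa using hx0
  rw [← eq_div_iff hne] at hprod
  rw [← hprod]
  exact (Summable.of_abs hs).hasSum

/-! ### Taylor expansion of `t / sinh t`. -/

/-- The negated Taylor coefficients of `t / sinh t` at even exponents. -/
noncomputable def cschCoeff (k : ℕ) : ℝ :=
  ((2 : ℝ) ^ (2 * k) - 2) * (bernoulli (2 * k) : ℝ) / ((2 * k).factorial : ℝ)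

/-- The factor `2 ^ (2 * k)` is absorbed by evaluating the Bernoulli series at `x = 2 < 2π`. -/
theorem summable_abs_cschCoeff : Summable (fun k => |cschCoeff k|) := by
  have h := summable_abs_bernoulli_mul_pow (x := 2) (by norm_num; linarith [Real.pi_gt_three])
  have h2 : Summable (fun k : ℕ => 3 * |(bernoulli (2 * k) : ℝ) / ((2 * k).factorial : ℝ) *
      2 ^ (2 * k)|) :=
    (h.comp_injective (i := fun k : ℕ => 2 * k) (fun a b hab => by simpa using hab)).mul_left 3
  refine h2.of_nonneg_of_le (fun k => abs_nonneg _) fun k => ?_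
  have h1 : (1 : ℝ) ≤ 2 ^ (2 * k) := one_le_pow₀ (by norm_num)
  have h3 : |(2 : ℝ) ^ (2 * k) - 2| ≤ 3 * 2 ^ (2 * k) := by
    rw [abs_le]; constructor <;> linarith
  rw [cschCoeff, mul_div_assoc, abs_mul, abs_mul _ ((2 : ℝ) ^ (2 * k)),
    abs_of_pos (by positivity : (0 : ℝ) < 2 ^ (2 * k))]
  nlinarith [abs_nonneg ((bernoulli (2 * k) : ℝ) / ((2 * k).factorial : ℝ))]

/-- From `t / sinh t = 2 · t/(e^t - 1) - 2t/(e^(2t) - 1)`; the second term requires `2t < 2π`. -/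
theorem hasSum_cschCoeff_mul_pow {t : ℝ} (ht0 : 0 < t) (ht : t < Real.pi) :
    HasSum (fun k : ℕ => -(cschCoeff k * t ^ (2 * k))) (t / Real.sinh t) := by
  have h1 := hasSum_bernoulli_mul_pow (x := t)
    (by rw [abs_of_pos ht0]; linarith [Real.pi_pos]) ht0.ne'
  have h2 := hasSum_bernoulli_mul_pow (x := 2 * t)
    (by rw [abs_of_pos (by positivity)]; linarith) (by positivity)
  have h := (h1.mul_left 2).sub h2
  have hval : 2 * (t / (Real.exp t - 1)) - 2 * t / (Real.exp (2 * t) - 1) = t / Real.sinh t := by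
    have he : 1 < Real.exp t := by simpa using ht0
    have hsq : Real.exp (2 * t) = Real.exp t ^ 2 := by rw [← Real.exp_nat_mul]; simp
    rw [Real.sinh_eq, Real.exp_neg, hsq]
    have e1 : Real.exp t - 1 ≠ 0 := by linarith
    have e2 : Real.exp t ^ 2 - 1 ≠ 0 := by nlinarith
    have e3 : Real.exp t ≠ 0 := by positivity
    have e4 : Real.exp t - (Real.exp t)⁻¹ = (Real.exp t ^ 2 - 1) / Real.exp t := by
      field_simp
    rw [e4]
    field_simp
    ring
  rw [hval] at h
  have hinj : Function.Injective (fun k : ℕ => 2 * k) := fun a b hab => by simpa using hab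
  rw [← hinj.hasSum_iff] at h
  · convert! h using 1
    funext k
    simp only [Function.comp_apply, cschCoeff, mul_pow]
    ring
  · intro j hj
    have hodd : Odd j := by
      rw [← Nat.not_even_iff_odd]
      rintro ⟨r, rfl⟩
      exact hj ⟨r, two_mul r⟩
    -- `B_1` is nonzero, but its factor `2 - 2 ^ 1` vanishes.
    rcases eq_or_ne j 1 with rfl | hj1
    · simp; ring
    · rw [bernoulli_eq_zero_of_odd hodd (by have := hodd.pos; omega)]
      simp

/-! ### Mellin transform of `csch`, split at `t = 1`. -/

/-- The hyperbolic cosecant on the real line, with complex values. -/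
noncomputable def csch (t : ℝ) : ℂ := (((Real.sinh t)⁻¹ : ℝ) : ℂ)

theorem continuousOn_csch : ContinuousOn csch (Set.Ioi 0) := by
  refine Complex.continuous_ofReal.comp_continuousOn
    (Real.continuous_sinh.continuousOn.inv₀ fun t ht => ?_)
  exact (Real.sinh_pos_iff.2 ht).ne'

theorem csch_isBigO_atTop (a : ℝ) :
    csch =O[Filter.atTop] (fun t : ℝ => t ^ (-a)) := by
  refine Asymptotics.IsBigO.trans ?_ (isLittleO_exp_neg_mul_rpow_atTop one_pos (-a)).isBigO
  refine Asymptotics.IsBigO.of_bound 4 ?_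
  filter_upwards [Filter.eventually_ge_atTop 1] with t ht
  have h1 : (2 : ℝ) ≤ Real.exp t := by linarith [Real.add_one_le_exp t]
  have h2 : Real.exp (-t) ≤ 1 := by rw [Real.exp_le_one_iff]; linarith
  have hs : Real.exp t / 4 ≤ Real.sinh t := by rw [Real.sinh_eq]; linarith
  have hp : 0 < Real.sinh t := Real.sinh_pos_iff.2 (by linarith)
  rw [csch, Complex.norm_real, Real.norm_of_nonneg (by positivity),
    Real.norm_of_nonneg (by positivity), neg_one_mul, Real.exp_neg]
  calc (Real.sinh t)⁻¹ ≤ (Real.exp t / 4)⁻¹ := inv_anti₀ (by positivity) hs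
    _ = 4 * (Real.exp t)⁻¹ := by rw [inv_div]; rfl

theorem csch_isBigO_nhdsGT_zero :
    csch =O[nhdsWithin 0 (Set.Ioi 0)] (fun t : ℝ => t ^ (-1 : ℝ)) := by
  refine Asymptotics.IsBigO.of_bound 1 ?_
  filter_upwards [self_mem_nhdsWithin] with t ht
  have ht' : (0 : ℝ) < t := ht
  have hp : 0 < Real.sinh t := Real.sinh_pos_iff.2 ht
  rw [csch, Complex.norm_real, Real.norm_of_nonneg (by positivity),
    Real.norm_of_nonneg (by positivity), Real.rpow_neg_one, one_mul]
  exact inv_anti₀ ht' (Real.self_le_sinh_iff.2 ht'.le)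

theorem mellinConvergent_csch {s : ℂ} (hs : 1 < s.re) : MellinConvergent csch s :=
  mellinConvergent_of_isBigO_rpow (a := s.re + 1) (b := 1)
    (continuousOn_csch.locallyIntegrableOn measurableSet_Ioi)
    (csch_isBigO_atTop _) (by linarith) csch_isBigO_nhdsGT_zero hs

/-- The hyperbolic cosecant cut off to `(1, ∞)`; its Mellin transform is entire. -/
noncomputable def cschTail : ℝ → ℂ := Set.indicator (Set.Ioi 1) csch

theorem hasDerivAt_mellin_cschTail (s : ℂ) :
    MellinConvergent (fun t => Real.log t • cschTail t) s ∧
      HasDerivAt (mellin cschTail) (mellin (fun t => Real.log t • cschTail t) s) s := by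
  -- Any exponents bracketing `s.re` would do: the tail decays faster than every power and vanishes
  -- near `0`.
  refine mellin_hasDerivAt_of_isBigO_rpow (a := s.re + 1) (b := s.re - 1) ?_ ?_ (by linarith) ?_
    (by linarith)
  · have := (continuousOn_csch.locallyIntegrableOn (μ := volume) measurableSet_Ioi)
    rw [locallyIntegrableOn_iff isOpen_Ioi.isLocallyClosed] at this ⊢
    intro k hk hk'
    exact (this k hk hk').indicator measurableSet_Ioi
  · refine (Asymptotics.isBigO_congr (Filter.EventuallyEq.symm ?_) Filter.EventuallyEq.rfl).1
      (csch_isBigO_atTop _)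
    filter_upwards [Filter.eventually_gt_atTop 1] with t ht
    exact Set.indicator_of_mem ht _
  · refine (Asymptotics.isBigO_congr (Filter.EventuallyEq.symm ?_) Filter.EventuallyEq.rfl).1
      (Asymptotics.isBigO_zero _ _)
    filter_upwards [mem_nhdsWithin_of_mem_nhds (Iio_mem_nhds (zero_lt_one' ℝ))] with t ht
    exact Set.indicator_of_notMem (by simpa using le_of_lt ht) _

/-- Termwise integration of the Taylor series, legitimate because `1 < π` and the integrals of the
norms are bounded by `|cschCoeff k| / (s.re - 1)`. -/
theorem hasSum_setIntegral_Ioc_csch {s : ℂ} (hs : 1 < s.re) :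
    HasSum (fun k : ℕ => -(cschCoeff k : ℂ) / (2 * k + s - 1))
      (∫ t in Set.Ioc (0 : ℝ) 1, (t : ℂ) ^ (s - 1) • csch t) := by
  have hre (k : ℕ) : -1 < (2 * (k : ℂ) + s - 2).re := by
    simp
    have : (0 : ℝ) ≤ k := k.cast_nonneg
    linarith
  have hint (k : ℕ) : ∫ t in Set.Ioc (0 : ℝ) 1, (t : ℂ) ^ (2 * (k : ℂ) + s - 2) =
      1 / (2 * k + s - 1) := by
    rw [← intervalIntegral.integral_of_le zero_le_one, integral_cpow (Or.inl (hre k))]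
    have : 2 * (k : ℂ) + s - 2 + 1 ≠ 0 := by
      intro h
      have h1 := congrArg Complex.re h
      have h2 := hre k
      simp only [Complex.add_re, Complex.one_re, Complex.zero_re] at h1
      linarith
    rw [Complex.ofReal_one, Complex.one_cpow, Complex.ofReal_zero, Complex.zero_cpow this]
    congr 1 <;> ring
  have hintr (k : ℕ) : ∫ t in Set.Ioc (0 : ℝ) 1, t ^ (2 * (k : ℝ) + s.re - 2) =
      1 / (2 * k + s.re - 1) := by
    have hk : (0 : ℝ) ≤ k := k.cast_nonneg
    rw [← intervalIntegral.integral_of_le zero_le_one, integral_rpow (Or.inl (by linarith)),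
      Real.one_rpow, Real.zero_rpow (by linarith)]
    congr 1 <;> ring
  have key := hasSum_integral_of_summable_integral_norm
    (μ := volume.restrict (Set.Ioc (0 : ℝ) 1))
    (F := fun (k : ℕ) (t : ℝ) => -(cschCoeff k : ℂ) * (t : ℂ) ^ (2 * (k : ℂ) + s - 2))
    (fun k => ?_) ?_
  · convert! key using 1
    · funext k
      rw [integral_const_mul, hint, mul_one_div]
    · refine setIntegral_congr_fun measurableSet_Ioc fun t ht => ?_
      have h := hasSum_cschCoeff_mul_pow ht.1 (ht.2.trans_lt (by linarith [Real.pi_gt_three]))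
      have hC := (Complex.hasSum_ofReal.2 h).mul_left ((t : ℂ) ^ (s - 2))
      have ht0 : (t : ℂ) ≠ 0 := Complex.ofReal_ne_zero.2 ht.1.ne'
      have hval : (t : ℂ) ^ (s - 2) * ((t / Real.sinh t : ℝ) : ℂ) = (t : ℂ) ^ (s - 1) • csch t := by
        rw [smul_eq_mul, csch, show s - 1 = s - 2 + 1 by ring, Complex.cpow_add _ _ ht0,
          Complex.cpow_one, div_eq_mul_inv]
        push_cast
        ring
      rw [hval] at hC
      rw [← hC.tsum_eq]
      refine tsum_congr fun k => ?_
      rw [show 2 * (k : ℂ) + s - 2 = (s - 2) + ((2 * k : ℕ) : ℂ) by push_cast; ring,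
        Complex.cpow_add _ _ ht0, Complex.cpow_natCast]
      push_cast
      ring
  · refine Integrable.const_mul ?_ _
    rw [← IntegrableOn, ← intervalIntegrable_iff_integrableOn_Ioc_of_le zero_le_one]
    exact intervalIntegral.intervalIntegrable_cpow' (hre k)
  · refine (summable_abs_cschCoeff.mul_right (1 / (s.re - 1))).of_nonneg_of_le
      (fun k => integral_nonneg fun t => norm_nonneg _) fun k => ?_
    have hk : (0 : ℝ) ≤ k := k.cast_nonneg
    have : ∫ t in Set.Ioc (0 : ℝ) 1, ‖-(cschCoeff k : ℂ) * (t : ℂ) ^ (2 * (k : ℂ) + s - 2)‖ =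
        |cschCoeff k| * (1 / (2 * k + s.re - 1)) := by
      rw [← hintr, ← integral_const_mul]
      refine setIntegral_congr_fun measurableSet_Ioc fun t ht => ?_
      rw [norm_mul, norm_neg, Complex.norm_real, Real.norm_eq_abs,
        Complex.norm_cpow_eq_rpow_re_of_pos ht.1]
      simp
    rw [this]
    refine mul_le_mul_of_nonneg_left ?_ (abs_nonneg _)
    exact one_div_le_one_div_of_le (by linarith) (by linarith)

/-- The meromorphic continuation of the Mellin transform of `csch`, split at `t = 1`. -/
noncomputable def cschContinuation (s : ℂ) : ℂ :=
  (∑' k : ℕ, -(cschCoeff k : ℂ) / (2 * k + s - 1)) + mellin cschTail s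

theorem mellin_csch_eq_cschContinuation {s : ℂ} (hs : 1 < s.re) :
    mellin csch s = cschContinuation s := by
  have hc := mellinConvergent_csch hs
  rw [MellinConvergent] at hc
  rw [cschContinuation, (hasSum_setIntegral_Ioc_csch hs).tsum_eq, mellin, mellin,
    ← Set.Ioc_union_Ioi_eq_Ioi (zero_le_one' ℝ),
    setIntegral_union (Set.Ioc_disjoint_Ioi le_rfl) measurableSet_Ioi
      (hc.mono_set Set.Ioc_subset_Ioi_self) (hc.mono_set (Set.Ioi_subset_Ioi zero_le_one)),
    Set.Ioc_union_Ioi_eq_Ioi (zero_le_one' ℝ)]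
  congr 1
  have (t : ℝ) : (t : ℂ) ^ (s - 1) • cschTail t =
      Set.indicator (Set.Ioi 1) (fun t : ℝ => (t : ℂ) ^ (s - 1) • csch t) t := by
    by_cases ht : t ∈ Set.Ioi (1 : ℝ)
    · simp only [cschTail, Set.indicator_of_mem ht]
    · simp only [cschTail, Set.indicator_of_notMem ht, smul_zero]
  simp_rw [this]
  rw [setIntegral_indicator measurableSet_Ioi, Set.Ioi_inter_Ioi, max_eq_right zero_le_one]

/-! ### The same Mellin transform in terms of `ζ`. -/

theorem hasSum_one_div_odd_cpow {s : ℂ} (hs : 1 < s.re) :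
    HasSum (fun k : ℕ => 1 / ((2 * k + 1 : ℕ) : ℂ) ^ s) ((1 - 2 ^ (-s)) * riemannZeta s) := by
  have hsum : Summable (fun m : ℕ => 1 / (m : ℂ) ^ s) := Complex.summable_one_div_nat_cpow.2 hs
  have hz : HasSum (fun m : ℕ => 1 / (m : ℂ) ^ s) (riemannZeta s) := by
    rw [zeta_eq_tsum_one_div_nat_cpow hs]; exact hsum.hasSum
  have he : HasSum (fun k : ℕ => 1 / ((2 * k : ℕ) : ℂ) ^ s) (2 ^ (-s) * riemannZeta s) := by
    convert! hz.mul_left ((2 : ℂ) ^ (-s)) using 1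
    funext k
    have := Complex.natCast_mul_natCast_cpow 2 k s
    rw [Nat.cast_mul, this, Complex.cpow_neg, Nat.cast_ofNat]
    rw [one_div, mul_inv, one_div]
  have ho : Summable (fun k : ℕ => 1 / ((2 * k + 1 : ℕ) : ℂ) ^ s) :=
    hsum.comp_injective (i := fun k : ℕ => 2 * k + 1) (fun a b hab => by simpa using hab)
  have h := (HasSum.even_add_odd (f := fun m : ℕ => 1 / (m : ℂ) ^ s) he ho.hasSum).unique hz
  have hval : ∑' k : ℕ, 1 / ((2 * k + 1 : ℕ) : ℂ) ^ s = (1 - 2 ^ (-s)) * riemannZeta s := by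
    linear_combination h
  rw [← hval]
  exact ho.hasSum

/-- Integrates `1 / sinh t = 2 ∑ exp (-(2k+1)t)`, a geometric series in `exp (-2t)`, term by term.
-/
theorem mellin_csch {s : ℂ} (hs : 1 < s.re) :
    mellin csch s = 2 * Complex.Gamma s * (1 - 2 ^ (-s)) * riemannZeta s := by
  have h := hasSum_mellin (ι := ℕ) (a := fun _ => 2) (p := fun k => 2 * k + 1) (F := csch) (s := s)
    (fun k => Or.inr (by positivity)) (by linarith) (fun t ht => ?_) ?_
  · refine h.unique ?_
    convert! (hasSum_one_div_odd_cpow hs).mul_left (2 * Complex.Gamma s) using 1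
    · funext k
      push_cast
      ring
    · ring
  · have ht' : (0 : ℝ) < t := ht
    have he : Real.exp (-(2 * t)) < 1 := by rw [Real.exp_lt_one_iff]; linarith
    have hg := (hasSum_geometric_of_lt_one (Real.exp_pos _).le he).mul_left (2 * Real.exp (-t))
    have hv : 2 * Real.exp (-t) * (1 - Real.exp (-(2 * t)))⁻¹ = (Real.sinh t)⁻¹ := by
      have h2 : Real.exp (-(2 * t)) = Real.exp (-t) ^ 2 := by
        rw [← Real.exp_nat_mul]; congr 1; push_cast; ring
      have h3 : Real.sinh t = (1 - Real.exp (-(2 * t))) / (2 * Real.exp (-t)) := by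
        rw [h2, Real.sinh_eq, Real.exp_neg]
        field_simp
      rw [h3, inv_div, div_eq_mul_inv]
    rw [hv] at hg
    convert! Complex.hasSum_ofReal.2 hg using 1
    funext k
    rw [show (-(2 * (k : ℝ) + 1) * t) = -t + k * (-(2 * t)) by ring, Real.exp_add,
      Real.exp_nat_mul]
    push_cast
    ring
  · have := (hasSum_one_div_odd_cpow (s := (s.re : ℂ)) (by simpa using hs)).summable.norm.mul_left 2
    refine this.congr fun k => ?_
    rw [norm_div, norm_one, Complex.norm_natCast_cpow_of_pos (by omega)]
    simp
    ring

/-! ### Analytic continuation to the regular set. -/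

/-- The complement of the odd integers and `0`. -/
def regularSet : Set ℂ := {s | Complex.cos (Real.pi * s / 2) ≠ 0 ∧ s ≠ 0}

theorem isOpen_regularSet : IsOpen regularSet :=
  (isOpen_ne_fun (f := fun s : ℂ => Complex.cos (Real.pi * s / 2)) (by fun_prop)
    continuous_const).inter isOpen_ne

/-- Removing a countable set from a real vector space of dimension at least 2 leaves it path
connected. -/
theorem isPreconnected_regularSet : IsPreconnected regularSet := by
  have hc : (regularSetᶜ).Countable := by
    refine ((Set.countable_range (fun k : ℤ => (2 * k + 1 : ℂ))).union
      (Set.countable_singleton 0)).mono fun s hs => ?_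
    simp only [regularSet, Set.mem_compl_iff, Set.mem_ofPred_eq, not_and_or, not_not] at hs
    refine hs.imp (fun h => ?_) id
    obtain ⟨k, hk⟩ := Complex.cos_eq_zero_iff.1 h
    refine ⟨k, ?_⟩
    have hpi : (Real.pi : ℂ) ≠ 0 := Complex.ofReal_ne_zero.2 Real.pi_ne_zero
    have h2 : (Real.pi : ℂ) * s = Real.pi * (2 * k + 1) := by linear_combination 2 * hk
    exact (mul_left_cancel₀ hpi h2).symm
  have h := hc.isPathConnected_compl_of_one_lt_rank (by simp [Complex.rank_real_complex])
  rw [compl_compl] at h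
  exact h.isConnected.isPreconnected

theorem one_sub_two_mul_notMem_regularSet (k : ℕ) : (1 - 2 * k : ℂ) ∉ regularSet := by
  rintro ⟨h, -⟩
  refine h (Complex.cos_eq_zero_iff.2 ⟨-k, ?_⟩)
  push_cast
  ring

theorem hasDerivAt_tsum_cschCoeff {s₀ : ℂ} (hs₀ : s₀ ∈ regularSet) :
    HasDerivAt (fun s : ℂ => ∑' k : ℕ, -(cschCoeff k : ℂ) / (2 * k + s - 1))
      (∑' k : ℕ, (cschCoeff k : ℂ) / (2 * k + s₀ - 1) ^ 2) s₀ := by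
  -- The poles `1 - 2k` are at distance at least `ε` from `s₀`, hence at least `ε / 2` from every
  -- point of the half ball; this bounds all denominators uniformly in `k`.
  obtain ⟨ε, hε, hball⟩ := Metric.isOpen_iff.1 isOpen_regularSet s₀ hs₀
  have hdist (k : ℕ) {s : ℂ} (hs : s ∈ Metric.ball s₀ (ε / 2)) :
      ε / 2 ≤ ‖2 * (k : ℂ) + s - 1‖ := by
    have h1 : ε ≤ dist (1 - 2 * k : ℂ) s₀ :=
      not_lt.1 fun h => one_sub_two_mul_notMem_regularSet k (hball h)
    have h2 := dist_triangle (1 - 2 * k : ℂ) s s₀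
    rw [Metric.mem_ball] at hs
    have h3 : dist (1 - 2 * k : ℂ) s = ‖2 * (k : ℂ) + s - 1‖ := by
      rw [dist_comm, dist_eq_norm]; congr 1; ring
    linarith
  have hne (k : ℕ) {s : ℂ} (hs : s ∈ Metric.ball s₀ (ε / 2)) : 2 * (k : ℂ) + s - 1 ≠ 0 :=
    norm_pos_iff.1 ((half_pos hε).trans_le (hdist k hs))
  have hmem : s₀ ∈ Metric.ball s₀ (ε / 2) := Metric.mem_ball_self (half_pos hε)
  refine hasDerivAt_tsum_of_isPreconnected
    (g := fun (k : ℕ) (s : ℂ) => -(cschCoeff k : ℂ) / (2 * k + s - 1))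
    (g' := fun (k : ℕ) (s : ℂ) => (cschCoeff k : ℂ) / (2 * k + s - 1) ^ 2)
    (summable_abs_cschCoeff.mul_right (1 / (ε / 2) ^ 2)) Metric.isOpen_ball
    (convex_ball s₀ (ε / 2)).isPreconnected (fun k s hs => ?_) (fun k s hs => ?_) hmem ?_ hmem
  · have hd : HasDerivAt (fun s : ℂ => 2 * (k : ℂ) + s - 1) 1 s :=
      ((hasDerivAt_id s).const_add _).sub_const _
    convert! (hasDerivAt_const s (-(cschCoeff k : ℂ))).div hd (hne k hs) using 1
    ring
  · rw [norm_div, norm_pow, Complex.norm_real, Real.norm_eq_abs, div_eq_mul_one_div]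
    exact mul_le_mul_of_nonneg_left (one_div_le_one_div_of_le (by positivity)
      (pow_le_pow_left₀ (by positivity) (hdist k hs) 2)) (abs_nonneg _)
  · refine Summable.of_norm_bounded (summable_abs_cschCoeff.mul_right (1 / (ε / 2))) fun k => ?_
    rw [norm_div, norm_neg, Complex.norm_real, Real.norm_eq_abs, div_eq_mul_one_div]
    exact mul_le_mul_of_nonneg_left (one_div_le_one_div_of_le (by positivity) (hdist k hmem))
      (abs_nonneg _)

theorem hasDerivAt_cschContinuation {s : ℂ} (hs : s ∈ regularSet) :
    HasDerivAt cschContinuation ((∑' k : ℕ, (cschCoeff k : ℂ) / (2 * k + s - 1) ^ 2) +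
      mellin (fun t => Real.log t • cschTail t) s) s :=
  (hasDerivAt_tsum_cschCoeff hs).add (hasDerivAt_mellin_cschTail s).2

/-- The Mellin transform of `csch` in terms of `ζ`, via the functional equation. -/
noncomputable def cschZeta (s : ℂ) : ℂ :=
  (((2 * Real.pi : ℝ) : ℂ) ^ s - (Real.pi : ℂ) ^ s) * riemannZeta (1 - s) /
    Complex.cos (Real.pi * s / 2)

theorem hasDerivAt_cschZeta {s : ℂ} (hs : s ∈ regularSet) {D : ℂ}
    (hD : HasDerivAt riemannZeta D (1 - s)) :
    HasDerivAt cschZeta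
      ((((((2 * Real.pi : ℝ) : ℂ) ^ s * Real.log (2 * Real.pi) -
          (Real.pi : ℂ) ^ s * Real.log Real.pi) * riemannZeta (1 - s) -
        (((2 * Real.pi : ℝ) : ℂ) ^ s - (Real.pi : ℂ) ^ s) * D) * Complex.cos (Real.pi * s / 2) +
        (((2 * Real.pi : ℝ) : ℂ) ^ s - (Real.pi : ℂ) ^ s) * riemannZeta (1 - s) *
          (Complex.sin (Real.pi * s / 2) * (Real.pi / 2))) /
        Complex.cos (Real.pi * s / 2) ^ 2) s := by
  have hpow {c : ℝ} (hc : 0 < c) :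
      HasDerivAt (fun s : ℂ => (c : ℂ) ^ s) ((c : ℂ) ^ s * Real.log c) s := by
    have := (hasDerivAt_id s).const_cpow (c := (c : ℂ))
      (Or.inl (Complex.ofReal_ne_zero.2 hc.ne'))
    simpa [Complex.ofReal_log hc.le] using this
  have hzeta : HasDerivAt (fun s : ℂ => riemannZeta (1 - s)) (-D) s := by
    have := hD.comp s ((hasDerivAt_id s).const_sub 1)
    simpa [Function.comp_def] using this
  have hlin : HasDerivAt (fun s : ℂ => (Real.pi : ℂ) * s / 2) (Real.pi / 2) s := by
    simpa using ((hasDerivAt_id s).const_mul (Real.pi : ℂ)).div_const 2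
  convert! (((hpow Real.two_pi_pos).sub (hpow Real.pi_pos)).mul hzeta).div hlin.ccos hs.1 using 1
  simp only [Pi.sub_apply, Pi.mul_apply]
  ring

theorem differentiableOn_cschZeta : DifferentiableOn ℂ cschZeta regularSet := fun s hs =>
  (hasDerivAt_cschZeta hs (differentiableAt_riemannZeta (by
    intro h; exact hs.2 (by linear_combination -h))).hasDerivAt).differentiableAt.differentiableWithinAt

/-- The functional equation `ζ(1 - s) = 2 (2π)^(-s) Γ(s) cos(πs/2) ζ(s)` matches `cschZeta` with
`mellin_csch`. -/
theorem cschZeta_eq_cschContinuation_of_one_lt_re {s : ℂ} (hs : s ∈ regularSet) (h1 : 1 < s.re) :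
    cschZeta s = cschContinuation s := by
  have hfe := riemannZeta_one_sub (s := s)
    (fun m h => by
      have := congrArg Complex.re h
      have hm : (0 : ℝ) ≤ m := m.cast_nonneg
      simp at this
      linarith)
    (fun h => by simp [h] at h1)
  have h2pi : (2 * (Real.pi : ℂ)) ≠ 0 := by
    simp [Real.pi_ne_zero]
  have hmul : ((2 * Real.pi : ℝ) : ℂ) ^ s = 2 ^ s * (Real.pi : ℂ) ^ s := by
    rw [Complex.ofReal_mul, Complex.mul_cpow_ofReal_nonneg (by norm_num) Real.pi_pos.le]
    simp
  have hmul' : (2 * (Real.pi : ℂ)) ^ s = 2 ^ s * (Real.pi : ℂ) ^ s := by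
    rw [← hmul]; push_cast; rfl
  have h2 : (2 : ℂ) ^ s ≠ 0 := by simp [Complex.cpow_eq_zero_iff]
  have hpi : (Real.pi : ℂ) ^ s ≠ 0 := by simp [Complex.cpow_eq_zero_iff, Real.pi_ne_zero]
  have hcos := hs.1
  rw [← mellin_csch_eq_cschContinuation h1, mellin_csch h1, cschZeta, hfe, hmul, Complex.cpow_neg,
    Complex.cpow_neg, hmul']
  field_simp

theorem cschZeta_eqOn_cschContinuation : Set.EqOn cschZeta cschContinuation regularSet := by
  have hmem : (2 : ℂ) ∈ regularSet := by
    refine ⟨?_, two_ne_zero⟩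
    rw [mul_div_assoc, div_self two_ne_zero, mul_one, Complex.cos_pi]
    norm_num
  refine AnalyticOnNhd.eqOn_of_preconnected_of_eventuallyEq
    (differentiableOn_cschZeta.analyticOnNhd isOpen_regularSet)
    (DifferentiableOn.analyticOnNhd (fun s hs =>
      (hasDerivAt_cschContinuation hs).differentiableAt.differentiableWithinAt) isOpen_regularSet)
    isPreconnected_regularSet hmem ?_
  filter_upwards [isOpen_regularSet.mem_nhds hmem,
    (isOpen_lt continuous_const Complex.continuous_re).mem_nhds
      (show (1 : ℝ) < (2 : ℂ).re by norm_num)] with s hs h1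
  exact cschZeta_eq_cschContinuation_of_one_lt_re hs h1

/-! ### Evaluation at `s = -2n`. -/

theorem cos_neg_nat_mul_pi (n : ℕ) :
    Complex.cos (Real.pi * (-(2 * n : ℂ)) / 2) = (-1) ^ n := by
  rw [show (Real.pi : ℂ) * (-(2 * n : ℂ)) / 2 = -(n * Real.pi) by ring, Complex.cos_neg,
    ← Complex.ofReal_natCast, ← Complex.ofReal_mul, ← Complex.ofReal_cos, Real.cos_nat_mul_pi]
  push_cast
  rfl

theorem sin_neg_nat_mul_pi (n : ℕ) :
    Complex.sin (Real.pi * (-(2 * n : ℂ)) / 2) = 0 := by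
  rw [show (Real.pi : ℂ) * (-(2 * n : ℂ)) / 2 = -(n * Real.pi) by ring, Complex.sin_neg,
    Complex.sin_nat_mul_pi, neg_zero]

theorem neg_two_mul_nat_mem_regularSet {n : ℕ} (hn : 1 ≤ n) : -(2 * n : ℂ) ∈ regularSet := by
  refine ⟨?_, ?_⟩
  · rw [cos_neg_nat_mul_pi]; exact pow_ne_zero _ (by norm_num)
  · simp; omega

theorem cpow_mul_log_smul_cschTail (n : ℕ) {t : ℝ} :
    (t : ℂ) ^ (-(2 * n : ℂ) - 1) • (Real.log t • cschTail t) =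
      Set.indicator (Set.Ioi 1)
        (fun t : ℝ => ((Real.log t / (t ^ (2 * n + 1) * Real.sinh t) : ℝ) : ℂ)) t := by
  by_cases ht : t ∈ Set.Ioi (1 : ℝ)
  · have hpow : (t : ℂ) ^ (-(2 * n : ℂ) - 1) = ((t : ℂ) ^ (2 * n + 1))⁻¹ := by
      rw [show (-(2 * n : ℂ) - 1) = -((2 * n + 1 : ℕ) : ℂ) by push_cast; ring, Complex.cpow_neg,
        Complex.cpow_natCast]
    rw [cschTail, Set.indicator_of_mem ht, Set.indicator_of_mem ht, hpow, csch, smul_eq_mul,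
      Complex.real_smul, div_eq_mul_inv, mul_inv]
    push_cast
    ring
  · simp only [cschTail, Set.indicator_of_notMem ht, smul_zero]

theorem integrableOn_log_div_pow_mul_sinh (n : ℕ) :
    IntegrableOn (fun t : ℝ => Real.log t / (t ^ (2 * n + 1) * Real.sinh t)) (Set.Ioi 1) := by
  have h := (hasDerivAt_mellin_cschTail (-(2 * n : ℂ))).1
  simp only [MellinConvergent, cpow_mul_log_smul_cschTail] at h
  have h2 := (h.mono_set (Set.Ioi_subset_Ioi zero_le_one)).congr_fun
    (fun t ht => Set.indicator_of_mem ht _) measurableSet_Ioi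
  exact h2.re

theorem mellin_log_smul_cschTail (n : ℕ) :
    mellin (fun t => Real.log t • cschTail t) (-(2 * n : ℂ)) =
      ((∫ t in Set.Ioi (1 : ℝ), Real.log t / (t ^ (2 * n + 1) * Real.sinh t) : ℝ) : ℂ) := by
  simp only [mellin, cpow_mul_log_smul_cschTail]
  rw [setIntegral_indicator measurableSet_Ioi, Set.Ioi_inter_Ioi, max_eq_right zero_le_one,
    integral_complex_ofReal]

theorem cschCoeff_div_eq (n k : ℕ) :
    cschCoeff k / (2 * (n : ℝ) - 2 * (k : ℝ) + 1) ^ 2 =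
      ((2 : ℝ) ^ (2 * k) - 2) * (bernoulli (2 * k) : ℝ) /
        (((2 * k).factorial : ℝ) * (2 * (n : ℝ) - 2 * (k : ℝ) + 1) ^ 2) := by
  rw [cschCoeff, div_div]

theorem summable_cschCoeff_div (n : ℕ) :
    Summable (fun k : ℕ => cschCoeff k / (2 * (n : ℝ) - 2 * (k : ℝ) + 1) ^ 2) := by
  refine Summable.of_norm_bounded summable_abs_cschCoeff fun k => ?_
  -- The base is an odd integer, hence nonzero, so its square is at least 1.
  have h : (1 : ℝ) ≤ (2 * (n : ℝ) - 2 * (k : ℝ) + 1) ^ 2 := by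
    have hz : (1 : ℤ) ≤ (2 * (n : ℤ) - 2 * (k : ℤ) + 1) ^ 2 := by
      have : (2 * (n : ℤ) - 2 * (k : ℤ) + 1) ≠ 0 := by omega
      have := sq_pos_of_ne_zero this
      omega
    exact_mod_cast hz
  rw [norm_div, Real.norm_eq_abs, Real.norm_of_nonneg (by positivity)]
  exact div_le_self (abs_nonneg _) h

theorem tsum_cschCoeff_div (n : ℕ) :
    ∑' k : ℕ, (cschCoeff k : ℂ) / (2 * k + -(2 * n : ℂ) - 1) ^ 2 =
      ((∑' k : ℕ, cschCoeff k / (2 * (n : ℝ) - 2 * (k : ℝ) + 1) ^ 2 : ℝ) : ℂ) := by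
  rw [Complex.ofReal_tsum]
  refine tsum_congr fun k => ?_
  push_cast
  congr 1
  ring

theorem mainTheorem6 (n : ℕ) (hn : 1 ≤ n) :
    Summable (fun k : ℕ => ((2 : ℝ) ^ (2 * k) - 2) * (bernoulli (2 * k) : ℝ) /
      (((2 * k).factorial : ℝ) * (2 * (n : ℝ) - 2 * (k : ℝ) + 1) ^ 2)) ∧
    IntegrableOn (fun t : ℝ => Real.log t / (t ^ (2 * n + 1) * Real.sinh t)) (Set.Ioi 1) volume ∧
    HasDerivAt riemannZeta
      (((Real.log (Real.pi / (2 : ℝ) ^ ((1 : ℝ) / ((2 : ℝ) ^ (2 * n) - 1))) : ℝ) : ℂ) *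
          riemannZeta (2 * (n : ℂ) + 1) +
        (((-1 : ℝ) ^ n * (2 * Real.pi) ^ (2 * n) / ((2 : ℝ) ^ (2 * n) - 1) *
          ((∑' k : ℕ, ((2 : ℝ) ^ (2 * k) - 2) * (bernoulli (2 * k) : ℝ) /
              (((2 * k).factorial : ℝ) * (2 * (n : ℝ) - 2 * (k : ℝ) + 1) ^ 2)) +
            ∫ t in Set.Ioi (1 : ℝ), Real.log t / (t ^ (2 * n + 1) * Real.sinh t)) : ℝ) : ℂ))
      (2 * (n : ℂ) + 1) := by
  simp only [← cschCoeff_div_eq]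
  refine ⟨summable_cschCoeff_div n, integrableOn_log_div_pow_mul_sinh n, ?_⟩
  have hreg := neg_two_mul_nat_mem_regularSet hn
  have hn0 : (n : ℂ) ≠ 0 := by exact_mod_cast (by omega : n ≠ 0)
  -- Differentiability is known away from `1`; only the value of the derivative remains to be
  -- identified.
  have hdiff : HasDerivAt riemannZeta (deriv riemannZeta (2 * (n : ℂ) + 1)) (2 * (n : ℂ) + 1) :=
    (differentiableAt_riemannZeta (by simpa using hn0)).hasDerivAt
  convert! hdiff using 1
  have harg : 1 - -(2 * n : ℂ) = 2 * (n : ℂ) + 1 := by ring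
  have hF := hasDerivAt_cschZeta hreg (by rw [harg]; exact hdiff)
  have hG := (hasDerivAt_cschContinuation hreg).congr_of_eventuallyEq
    (cschZeta_eqOn_cschContinuation.eventuallyEq_of_mem (isOpen_regularSet.mem_nhds hreg))
  -- The two formulas for the derivative at `-2n` give the equation to be solved for `ζ'(2n+1)`.
  have heq := hF.unique hG
  rw [cos_neg_nat_mul_pi, sin_neg_nat_mul_pi, harg, tsum_cschCoeff_div,
    mellin_log_smul_cschTail, ← Complex.ofReal_add] at heq
  have hcpow {c : ℝ} : (c : ℂ) ^ (-(2 * n : ℂ)) = ((c : ℂ) ^ (2 * n))⁻¹ := by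
    rw [show (-(2 * n : ℂ)) = -((2 * n : ℕ) : ℂ) by push_cast; ring, Complex.cpow_neg,
      Complex.cpow_natCast]
  rw [hcpow, hcpow] at heq
  have h4 : (1 : ℝ) < 2 ^ (2 * n) := one_lt_pow₀ (by norm_num) (by omega)
  have hlog : Real.log (Real.pi / (2 : ℝ) ^ ((1 : ℝ) / ((2 : ℝ) ^ (2 * n) - 1))) =
      Real.log Real.pi - Real.log 2 / ((2 : ℝ) ^ (2 * n) - 1) := by
    rw [Real.log_div Real.pi_ne_zero (by positivity), Real.log_rpow two_pos]
    ring
  have hlog2 : Real.log (2 * Real.pi) = Real.log 2 + Real.log Real.pi :=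
    Real.log_mul two_ne_zero Real.pi_ne_zero
  rw [hlog]
  rw [hlog2] at heq
  set B : ℝ := (∑' k : ℕ, cschCoeff k / (2 * (n : ℝ) - 2 * (k : ℝ) + 1) ^ 2) +
    ∫ t in Set.Ioi (1 : ℝ), Real.log t / (t ^ (2 * n + 1) * Real.sinh t)
  -- With the transcendental quantities abstracted, `heq` is linear in `D` with a coefficient
  -- proportional to `2 ^ (2 * n) - 1`, nonzero by `h4'`.
  generalize deriv riemannZeta (2 * (n : ℂ) + 1) = D at heq ⊢
  generalize riemannZeta (2 * (n : ℂ) + 1) = Z at heq ⊢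
  have h4' : (2 : ℂ) ^ (2 * n) - 1 ≠ 0 := by
    have : (((2 : ℝ) ^ (2 * n) - 1 : ℝ) : ℂ) ≠ 0 := Complex.ofReal_ne_zero.2 (by linarith)
    simpa using this
  have hε0 : (-1 : ℂ) ^ n ≠ 0 := pow_ne_zero _ (by norm_num)
  push_cast at heq ⊢
  rw [mul_pow] at heq ⊢
  have hp0 : (Real.pi : ℂ) ^ (2 * n) ≠ 0 := pow_ne_zero _ (by simp [Real.pi_ne_zero])
  have hq0 : (2 : ℂ) ^ (2 * n) ≠ 0 := pow_ne_zero _ two_ne_zero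
  generalize (Real.pi : ℂ) ^ (2 * n) = P at *
  generalize (2 : ℂ) ^ (2 * n) = Q at *
  generalize (-1 : ℂ) ^ n = E at *
  rw [← heq]
  field_simp
  ring
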